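/- **Conventions.** Let $\mathcal V$ be the fermionic Fock space (semi-infinite wedge space) with basis the wedge products $v_{s_1}\wedge v_{s_2}\wedge\cdots$ of half-integers $s_1>s_2>\cdots$ that contain almost all negative and almost no positive half-integers, vacuum $|0\rangle=v_{-1/2}\wedge v_{-3/2}\wedge\cdots$, and let $\langle g\rangle=\langle 0|g|0\rangle$ denote the coefficient of $|0\rangle$ in $g|0\rangle$. For half-integers $i\neq j$ let $E_{i,j}$ be the operator replacing the factor $v_j$ by $v_i$. For $n\neq 0$ set $$\mathcal E_n(u)=\sum_{s\in\mathbb Z+1/2}e^{u(s-n/2)}E_{s-n,s},\qquad J_n=\mathcal E_n(0),$$ and for $k\ge 1$ define the $k$-leaky $r$-completed cycles operators $\mathcal F^k_r$ by $\mathcal E_{-k}(u)=\sum_{r\ge 0}\mathcal F^k_r\,u^r/r!$. Let $k,r,q\ge 1$. For $\mu=(\mu_1,\dots,\mu_N)$ with $\mu_i\ge1$ put $$H^\bullet_\mu(\beta,s)=\frac{1}{\mu_1\cdots\mu_N}\Big\langle J_{\mu_1}\cdots J_{\mu_N}\,e^{\beta\mathcal F^k_r/r}\,e^{sJ_{-q}/q}\Big\rangle,\qquad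 H_\mu=\sum_{I\vdash\{1,\dots,N\}}(-1)^{|I|-1}(|I|-1)!\prod_{i=1}^{|I|}H^\bullet_{\mu_{I_i}},$$ where the second sum is over set partitions $I=\{I_1,\dots,I_{|I|}\}$ of the labels. The connected orbifold leaky completed cycles Hurwitz number of genus $g$ is $$\mathrm{lh}^{k,r,q}_{g,\mu}=\sum_{\substack{b,n\ge 0\\(r-1)b-n=2g-2+N}}b!\,[\beta^bs^n]\,H_\mu(\beta,s).$$ (The sum is finite, because only terms with $\sum_i\mu_i=qn+kb$ can be non-zero.) **Theorem.** Let $k,r,q,l,m$ be positive integers, and set $A=\frac kr$, $B=q(r-1)+k$ and, if $B\mid l+m$, $b=\frac{l+m}{B}$. Then $$\mathrm{lh}^{k,r,q}_{0,(l,m)}=\begin{cases}0&\text{if } l+m\not\equiv0\pmod B,\\[4pt]\dfrac{b!}{l+m}\,A^{\frac{l+m}{B}-2}\,B\cdot A\dbinom{\frac lA-1}{\lfloor l/B\rfloor}\dbinom{\frac mA-1}{\lfloor m/B\rfloor}&\text{if } l\equiv-m\not\equiv0\pmod B,\\[8pt]\dfrac{b!}{l+m}\,A^{\frac{l+m}{B}-2}\,B\,(B-A)\dbinom{\frac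 lA-1}{\frac{l-B}{B}}\dbinom{\frac mA-1}{\frac{m-B}{B}}&\text{if } l\equiv m\equiv0\pmod B,\end{cases}$$ where $\binom{x}{j}=\frac{x(x-1)\cdots(x-j+1)}{j!}$ for $x\in\mathbb Q$ and $j\in\mathbb Z_{\ge0}$. -/

import Mathlib

open scoped Nat PowerSeries

namespace LeakyHurwitz

/-- Indices of basis vectors of the semi-infinite wedge space. The half-integer `i + 1/2` is encoded
by the integer `i`. A Maya diagram is a set of half-integers which contains only finitely many
positive ones and all but finitely many negative ones; it stands for the wedge product
`v_{s₁} ∧ v_{s₂} ∧ ⋯` of its elements `s₁ > s₂ > ⋯`. -/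
@[ext]
structure MayaDiagram where
  carrier : Set ℤ
  finite_pos : {i : ℤ | i ∈ carrier ∧ 0 ≤ i}.Finite
  finite_neg : {i : ℤ | i ∉ carrier ∧ i < 0}.Finite

/-- The vacuum `v_{-1/2} ∧ v_{-3/2} ∧ ⋯`. -/
def MayaDiagram.vacuum : MayaDiagram where
  carrier := {i | i < 0}
  finite_pos := by
    convert Set.finite_empty (α := ℤ)
    ext i
    simp
  finite_neg := by
    convert Set.finite_empty (α := ℤ)
    ext i
    simp

/-- The diagram obtained by removing `j` and adding `i`. -/
def MayaDiagram.move (S : MayaDiagram) (i j : ℤ) : MayaDiagram where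
  carrier := insert i (S.carrier \ {j})
  finite_pos := by
    refine (S.finite_pos.union (Set.finite_singleton i)).subset ?_
    rintro x ⟨hx, h0⟩
    rcases hx with rfl | hx
    · exact Or.inr rfl
    · exact Or.inl ⟨hx.1, h0⟩
  finite_neg := by
    refine (S.finite_neg.union (Set.finite_singleton j)).subset ?_
    rintro x ⟨hx, h0⟩
    by_cases hj : x = j
    · exact Or.inr hj
    · exact Or.inl ⟨fun h => hx (Or.inr ⟨h, hj⟩), h0⟩

/-- Fermionic Fock space (the semi-infinite wedge space). All charges are allowed; the operators
below preserve the charge and the vacuum has charge zero, so vacuum expectation values only involve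
the charge zero part. -/
abbrev Fock : Type := MayaDiagram →₀ ℚ

open Classical in
/-- The action of the matrix unit `E_{i + 1/2, j + 1/2}` on a basis vector. For `i ≠ j` it replaces the
factor `v_j` by `v_i`, the sign coming from reordering the wedge product; for `i = j` it is the normally
ordered number operator. This is the standard action in which the central element acts as `1`. -/
noncomputable def matrixUnit (i j : ℤ) (S : MayaDiagram) : Fock :=
  if i = j then
    Finsupp.single S ((if j ∈ S.carrier then 1 else 0) - (if j < 0 then 1 else 0))
  else if j ∈ S.carrier ∧ i ∉ S.carrier then
    Finsupp.single (S.move i j)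
      ((-1) ^ Set.ncard {t : ℤ | t ∈ S.carrier ∧ min i j < t ∧ t < max i j})
  else 0

/-- The sum defining the operator `calE` below is finite on every basis vector. -/
theorem matrixUnit_finite (n : ℤ) (S : MayaDiagram) :
    {l : ℤ | matrixUnit (l - n) l S ≠ 0}.Finite := by
  classical
  refine ((S.finite_pos.union S.finite_neg).union
    ((S.finite_neg.image (fun i => i + n)).union (Set.finite_Icc (-|n|) |n|))).subset ?_
  intro l hl
  simp only [Set.mem_ofPred_eq, matrixUnit] at hl
  by_contra hcon
  simp only [Set.mem_union, Set.mem_ofPred_eq, Set.mem_image, Set.mem_Icc, not_or, not_and,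
    not_exists] at hcon
  obtain ⟨⟨h1, h2⟩, h3, h4⟩ := hcon
  apply hl
  by_cases hlS : l ∈ S.carrier
  · have hneg : l < 0 := by
      by_contra h
      exact h1 hlS (by omega)
    by_cases hn : n = 0
    · subst hn
      simp [hlS, hneg]
    · have hne : ¬ (l - n = l) := by omega
      have hmem : l - n ∈ S.carrier := by
        by_contra h
        have hlt : ¬ (l - n < 0) := fun h' => h3 (l - n) ⟨h, h'⟩ (by ring)
        have hle : n ≤ l := by omega
        have := h4 (by have := neg_abs_le n; omega)
        have := abs_nonneg n
        omega
      simp [hne, hmem]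
  · have hpos : ¬ l < 0 := fun h => h2 hlS h
    by_cases hn : n = 0
    · subst hn
      simp [hlS, hpos]
    · have hne : ¬ (l - n = l) := by omega
      simp [hne, hlS]

/-- For `n ≠ 0`, the operator `calE n r` is the coefficient of `u ^ r` in
`𝓔_n(u) = ∑_{s ∈ ℤ + 1/2} e ^ (u (s - n / 2)) E_{s - n, s}`. -/
noncomputable def calE (n : ℤ) (r : ℕ) : Module.End ℚ Fock :=
  Finsupp.linearCombination ℚ fun S : MayaDiagram =>
    ∑ᶠ l : ℤ, ((((l : ℚ) + 1 / 2) - (n : ℚ) / 2) ^ r / (r ! : ℚ)) • matrixUnit (l - n) l S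

/-- The Heisenberg operators `J_n = 𝓔_n(0)`, for `n ≠ 0`. -/
noncomputable def J (n : ℤ) : Module.End ℚ Fock := calE n 0

/-- The `k`-leaky `r`-completed cycles operator, defined for `k ≠ 0` by
`𝓔_{-k}(u) = ∑_r F_r^k u ^ r / r!`. -/
noncomputable def leakyF (k : ℤ) (r : ℕ) : Module.End ℚ Fock := (r ! : ℚ) • calE (-k) r

/-- The vacuum expectation value `⟨0| g |0⟩`. -/
noncomputable def vev (g : Module.End ℚ Fock) : ℚ :=
  g (Finsupp.single MayaDiagram.vacuum 1) MayaDiagram.vacuum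

/-- The coefficient of `X₁ ^ μ₁ ⋯ X_N ^ μ_N` in the disconnected `N`-point function, i.e.
`1 / (μ₁ ⋯ μ_N) ⟨J_{μ₁} ⋯ J_{μ_N} exp(β F_r^k / r) exp(s J_{-q} / q)⟩`,
as a power series in `β` (outer variable) and `s` (inner variable). -/
noncomputable def disconnected (k r q : ℕ) (μ : List ℕ) : ℚ⟦X⟧⟦X⟧ :=
  PowerSeries.mk fun b => PowerSeries.mk fun n =>
    (1 / ((μ.map fun a => (a : ℚ)).prod * (b ! : ℚ) * (n ! : ℚ))) *
      vev ((μ.map fun a => J (a : ℤ)).prod *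
        ((1 / (r : ℚ)) • leakyF (k : ℤ) r) ^ b * ((1 / (q : ℚ)) • J (-(q : ℤ))) ^ n)

/-- The coefficient of `X₁ ^ μ₁ ⋯ X_N ^ μ_N` in the connected `N`-point function (`N ≥ 1`), obtained from
the disconnected ones by inclusion-exclusion over the set partitions of the `N` labels. -/
noncomputable def connected (k r q : ℕ) {N : ℕ} (μ : Fin N → ℕ) : ℚ⟦X⟧⟦X⟧ :=
  ∑ P : Finpartition (Finset.univ : Finset (Fin N)),
    ((-1 : ℚ) ^ (P.parts.card - 1) * ((P.parts.card - 1)! : ℚ)) •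
      ∏ I ∈ P.parts, disconnected k r q ((I.sort (· ≤ ·)).map μ)

/-- The connected `k`-leaky `r`-completed cycles `q`-orbifold Hurwitz number of genus `g` with left
profile `μ` (labelled parts). The term with `b` cut-and-join operators and `n` right parts equal to `q`
has Euler characteristic `n - (r - 1) b`, i.e. it is the coefficient of `β ^ b s ^ n` after
`β ↦ ħ ^ (r - 1) β`, `s ↦ s / ħ` has put it in `ħ`-degree `(r - 1) b - n`, which has to be `2 g - 2 + N`;
it is weighted by `b!`, so that the cut-and-join operators are taken in a fixed order instead of being
divided by `b!`. Since `J_{μ₁} ⋯ J_{μ_N}` lowers the energy by `∑ μᵢ`, while `F_r^k` and `J_{-q}` raise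
it by `k` and `q`, only terms with `∑ μᵢ = q n + k b` are non-zero, so for `k, q ≥ 1` the sum is finite. -/
noncomputable def lh (k r q g : ℕ) {N : ℕ} (μ : Fin N → ℕ) : ℚ :=
  ∑ᶠ p : ℕ × ℕ,
    if ((r : ℤ) - 1) * (p.1 : ℤ) - (p.2 : ℤ) = 2 * (g : ℤ) - 2 + (N : ℤ) then
      (p.1 ! : ℚ) * PowerSeries.coeff p.2 (PowerSeries.coeff p.1 (connected k r q μ))
    else 0

end LeakyHurwitz

namespace LeakyHurwitz

open Finset (HasAntidiagonal)
open Finset.HasAntidiagonal (antidiagonal)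

/-! ### Fermions on the semi-infinite wedge space -/

/-! Put X = F_r^k / r and Y = J_{-q} / q. Both raise the energy, so the vacuum covector kills them
on the left, and moving them leftwards through J_l J_m replaces the exponentials by conjugation
(`vev_mul_pow_mul_pow`). Conjugation is multiplicative (`divComm_mul`), so the connected two-point
coefficient is a sum of terms ⟨PQ⟩ - ⟨P⟩⟨Q⟩ with P, Q conjugated currents.

Each conjugated current second-quantizes a one-particle operator ∑ f(i) E_{i+d,i} with f polynomial.
For such operators the connected pairing is a finite sum of values f·g over an interval, nonzero
only if the shifts cancel (`Implements.vev_mul_sub`). A commutator with X raises deg f by at most r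
- 1, and b of them give x^{b(r-1)} the coefficient A^b binom(l/A, b); a commutator with Y is a
finite difference and lowers the degree. Genus zero means that the Y's number exactly (r-1) times
the X's. Hence both polynomials must be constants given by these coefficients (`conjJ_implements`),
and the interval contributes only its length.

What is left is ∑ (l - iB)₊ binom(l/A, i) binom(m/A, b-i). Truncation stops it at i = ⌊l/B⌋, and its
partial sums telescope (`sum_sub_mul_choose_mul_choose`). The nonzero cases of the theorem differ
only in how ⌊l/B⌋ and ⌊m/B⌋ add up. -/

/-- The diagram obtained by adding `i` if it is absent, and removing it if it is present. -/
def MayaDiagram.toggle (S : MayaDiagram) (i : ℤ) : MayaDiagram where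
  carrier := symmDiff S.carrier {i}
  finite_pos := by
    refine (S.finite_pos.union (Set.finite_singleton i)).subset ?_
    rintro x ⟨hx, h0⟩
    rcases hx with hx | hx
    · exact Or.inl ⟨hx.1, h0⟩
    · exact Or.inr hx.1
  finite_neg := by
    refine (S.finite_neg.union (Set.finite_singleton i)).subset ?_
    rintro x ⟨hx, h0⟩
    by_cases hi : x = i
    · exact Or.inr hi
    · exact Or.inl ⟨fun h => hx (Or.inl ⟨h, hi⟩), h0⟩

theorem MayaDiagram.mem_toggle {S : MayaDiagram} {i j : ℤ} :
    j ∈ (S.toggle i).carrier ↔ (j ∈ S.carrier ↔ j ≠ i) := by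
  simp only [MayaDiagram.toggle, Set.mem_symmDiff, Set.mem_singleton_iff]
  tauto

theorem MayaDiagram.toggle_comm (S : MayaDiagram) (i j : ℤ) :
    (S.toggle i).toggle j = (S.toggle j).toggle i := by
  simp only [MayaDiagram.toggle, MayaDiagram.mk.injEq]
  exact symmDiff_right_comm _ _ _

theorem MayaDiagram.toggle_toggle (S : MayaDiagram) (i : ℤ) : (S.toggle i).toggle i = S := by
  ext1
  exact symmDiff_symmDiff_cancel_right _ _

/-- Guards the signs: `Set.ncard` of an infinite set would be the default value 0. -/
theorem MayaDiagram.finite_gt (S : MayaDiagram) (i : ℤ) :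
    {t : ℤ | t ∈ S.carrier ∧ i < t}.Finite := by
  refine (S.finite_pos.union (Set.finite_Icc i 0)).subset ?_
  rintro t ⟨ht, hit⟩
  by_cases h : 0 ≤ t
  · exact Or.inl ⟨ht, h⟩
  · exact Or.inr ⟨hit.le, by omega⟩

/-- The sign of moving `v_i` to its place in the wedge product `S`. -/
noncomputable def wedgeSign (S : MayaDiagram) (i : ℤ) : ℚ :=
  (-1) ^ Set.ncard {t : ℤ | t ∈ S.carrier ∧ i < t}

theorem wedgeSign_mul_self (S : MayaDiagram) (i : ℤ) : wedgeSign S i * wedgeSign S i = 1 := by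
  rw [wedgeSign, ← mul_pow]
  norm_num

theorem wedgeSign_toggle_of_le (S : MayaDiagram) {i j : ℤ} (h : j ≤ i) :
    wedgeSign (S.toggle j) i = wedgeSign S i := by
  unfold wedgeSign
  congr 2
  ext t
  simp only [Set.mem_ofPred_eq, MayaDiagram.mem_toggle]
  constructor
  · rintro ⟨h1, h2⟩
    exact ⟨h1.2 (by omega), h2⟩
  · rintro ⟨h1, h2⟩
    exact ⟨⟨fun _ => by omega, fun _ => h1⟩, h2⟩

theorem wedgeSign_toggle_of_lt (S : MayaDiagram) {i j : ℤ} (h : i < j) :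
    wedgeSign (S.toggle j) i = -wedgeSign S i := by
  have key : ∀ T : MayaDiagram, j ∉ T.carrier → wedgeSign (T.toggle j) i = -wedgeSign T i := by
    intro T hT
    have hset : {t : ℤ | t ∈ (T.toggle j).carrier ∧ i < t} =
        insert j {t : ℤ | t ∈ T.carrier ∧ i < t} := by
      ext t
      simp only [Set.mem_ofPred_eq, MayaDiagram.mem_toggle, Set.mem_insert_iff]
      by_cases htj : t = j
      · subst htj; simp [hT, h]
      · simp [htj]
    rw [wedgeSign, wedgeSign, hset, Set.ncard_insert_of_notMem (fun hj => hT hj.1) (T.finite_gt i),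
      pow_succ]
    ring
  by_cases hj : j ∈ S.carrier
  · have := key (S.toggle j) (by simp [MayaDiagram.mem_toggle, hj])
    rw [MayaDiagram.toggle_toggle] at this
    rw [this, neg_neg]
  · exact key S hj

/-- The operator `ψ_i + ψ_i^*`. -/
noncomputable def flip (i : ℤ) : Module.End ℚ Fock :=
  Finsupp.linearCombination ℚ fun S : MayaDiagram => Finsupp.single (S.toggle i) (wedgeSign S i)

open Classical in
/-- The occupation number operator `ψ_i ψ_i^*`. -/
noncomputable def occ (i : ℤ) : Module.End ℚ Fock :=
  Finsupp.linearCombination ℚ fun S : MayaDiagram =>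
    Finsupp.single S (if i ∈ S.carrier then 1 else 0)

/-- The operator `ψ_i` of exterior multiplication by `v_i`. -/
noncomputable def create (i : ℤ) : Module.End ℚ Fock := occ i * flip i

/-- The adjoint `ψ_i^*` of `ψ_i`. -/
noncomputable def annih (i : ℤ) : Module.End ℚ Fock := flip i * occ i

theorem flip_single (i : ℤ) (S : MayaDiagram) (c : ℚ) :
    flip i (Finsupp.single S c) = Finsupp.single (S.toggle i) (c * wedgeSign S i) := by
  simp [flip]

open Classical in
theorem occ_single (i : ℤ) (S : MayaDiagram) (c : ℚ) :
    occ i (Finsupp.single S c) = Finsupp.single S (if i ∈ S.carrier then c else 0) := by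
  simp [occ]

theorem end_ext {P Q : Module.End ℚ Fock}
    (h : ∀ S, P (Finsupp.single S 1) = Q (Finsupp.single S 1)) : P = Q := by
  ext1 S
  exact LinearMap.ext_ring (h S)

theorem end_mul_neg (P Q : Module.End ℚ Fock) : P * -Q = -(P * Q) := mul_neg P Q

theorem end_neg_mul (P Q : Module.End ℚ Fock) : -P * Q = -(P * Q) := neg_mul P Q

/-- The commutator of operators on Fock space. -/
noncomputable def comm (P Q : Module.End ℚ Fock) : Module.End ℚ Fock := P * Q - Q * P

theorem comm_def (P Q : Module.End ℚ Fock) : comm P Q = P * Q - Q * P := rfl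

theorem smul_comm_left (c : ℚ) (P Q : Module.End ℚ Fock) : comm (c • P) Q = c • comm P Q := by
  rw [comm, comm, smul_mul_assoc, mul_smul_comm, smul_sub]

theorem comm_smul_right (c : ℚ) (P Q : Module.End ℚ Fock) : comm P (c • Q) = c • comm P Q := by
  rw [comm, comm, smul_mul_assoc, mul_smul_comm, smul_sub]

theorem comm_comm (P Q T : Module.End ℚ Fock) :
    comm (comm P Q) T = comm P (comm Q T) - comm Q (comm P T) := by
  simp only [comm, sub_mul, mul_sub, mul_assoc]
  abel

theorem flip_mul_self (i : ℤ) : flip i * flip i = 1 := by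
  refine end_ext fun S => ?_
  simp [flip_single, MayaDiagram.toggle_toggle, wedgeSign_toggle_of_le, wedgeSign_mul_self]

/-- Toggling the larger index changes the sign at the smaller one but not conversely, so the two
orders differ by exactly one sign. All fermionic signs come from here, since `occ` is diagonal. -/
theorem flip_mul_flip {i j : ℤ} (h : i ≠ j) : flip i * flip j = -(flip j * flip i) := by
  refine end_ext fun S => ?_
  simp only [Module.End.mul_apply, flip_single, LinearMap.neg_apply, one_mul,
    S.toggle_comm i j, ← Finsupp.single_neg]
  congr 1
  rcases lt_or_gt_of_ne h with h | h
  · rw [wedgeSign_toggle_of_lt S h, wedgeSign_toggle_of_le S h.le]; ring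
  · rw [wedgeSign_toggle_of_lt S h, wedgeSign_toggle_of_le S h.le]; ring

theorem occ_mul_self (i : ℤ) : occ i * occ i = occ i := by
  classical
  refine end_ext fun S => ?_
  simp only [Module.End.mul_apply, occ_single]
  congr 1
  split_ifs <;> rfl

theorem occ_mul_occ (i j : ℤ) : occ i * occ j = occ j * occ i := by
  classical
  refine end_ext fun S => ?_
  simp only [Module.End.mul_apply, occ_single]
  congr 1
  split_ifs <;> rfl

theorem occ_mul_flip {i j : ℤ} (h : i ≠ j) : occ i * flip j = flip j * occ i := by
  classical
  refine end_ext fun S => ?_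
  simp only [Module.End.mul_apply, occ_single, flip_single, MayaDiagram.mem_toggle]
  congr 1
  simp [h]

theorem occ_mul_flip_self (i : ℤ) : occ i * flip i = flip i * (1 - occ i) := by
  classical
  refine end_ext fun S => ?_
  by_cases hi : i ∈ S.carrier <;>
    simp [occ_single, flip_single, MayaDiagram.mem_toggle, hi]

theorem create_eq (i : ℤ) : create i = flip i * (1 - occ i) := occ_mul_flip_self i

theorem annih_eq (i : ℤ) : annih i = (1 - occ i) * flip i := by
  rw [sub_mul, occ_mul_flip_self, annih, mul_sub, one_mul, mul_one, sub_sub_cancel]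

theorem flip_mul_create (i : ℤ) : flip i * create i = 1 - occ i := by
  rw [create_eq, ← mul_assoc, flip_mul_self, one_mul]

theorem flip_mul_annih (i : ℤ) : flip i * annih i = occ i := by
  rw [annih, ← mul_assoc, flip_mul_self, one_mul]

theorem create_mul_annih_self (i : ℤ) : create i * annih i = occ i := by
  rw [create, mul_assoc, flip_mul_annih, occ_mul_self]

theorem annih_mul_create_self (i : ℤ) : annih i * create i = 1 - occ i := by
  rw [annih_eq, mul_assoc, flip_mul_create, sub_mul, mul_sub, mul_sub, occ_mul_self]
  simp

theorem create_mul_create (i j : ℤ) : create i * create j = -(create j * create i) := by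
  by_cases h : i = j
  · subst h
    have : create i * create i = 0 := by
      nth_rewrite 1 [create]
      rw [mul_assoc, flip_mul_create, mul_sub, occ_mul_self, mul_one, sub_self]
    rw [this, neg_zero]
  · simp only [create]
    rw [mul_assoc, ← mul_assoc (flip i), ← occ_mul_flip (Ne.symm h), mul_assoc (occ j), ← mul_assoc,
      flip_mul_flip h, mul_assoc (occ j), ← mul_assoc (flip j) (occ i), ← occ_mul_flip h,
      mul_assoc (occ i) (flip j), ← mul_assoc (occ j) (occ i), occ_mul_occ i j, end_mul_neg]

theorem annih_mul_annih (i j : ℤ) : annih i * annih j = -(annih j * annih i) := by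
  by_cases h : i = j
  · subst h
    have : annih i * annih i = 0 := by
      nth_rewrite 1 [annih_eq]
      rw [mul_assoc, flip_mul_annih, sub_mul, occ_mul_self, one_mul, sub_self]
    rw [this, neg_zero]
  · simp only [annih]
    rw [mul_assoc, ← mul_assoc (occ i), occ_mul_flip h, mul_assoc (flip j), ← mul_assoc,
      flip_mul_flip h, mul_assoc (flip j) (occ j), ← mul_assoc (occ j) (flip i),
      occ_mul_flip (Ne.symm h), mul_assoc (flip i) (occ j), ← mul_assoc (flip j) (flip i),
      occ_mul_occ i j, end_neg_mul]

theorem create_mul_annih {i j : ℤ} (h : i ≠ j) : create i * annih j = -(annih j * create i) := by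
  rw [create, annih, mul_assoc, ← mul_assoc (flip i), flip_mul_flip h, end_neg_mul, end_mul_neg,
    mul_assoc (flip j), ← mul_assoc (occ i), occ_mul_flip h, ← occ_mul_flip (Ne.symm h),
    mul_assoc, mul_assoc, ← mul_assoc (occ i), ← mul_assoc (occ j), occ_mul_occ]

theorem comm_create (a b i : ℤ) :
    comm (create a * annih b) (create i) = if b = i then create a else 0 := by
  rw [comm_def, ← mul_assoc, create_mul_create i a]
  split_ifs with h
  · subst h
    rw [mul_assoc, annih_mul_create_self, end_neg_mul, mul_assoc, create_mul_annih_self]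
    simp [mul_sub]
  · rw [end_neg_mul, mul_assoc, mul_assoc, create_mul_annih (Ne.symm h), end_mul_neg]
    simp

theorem comm_annih (a b i : ℤ) :
    comm (create a * annih b) (annih i) = if a = i then -annih b else 0 := by
  rw [comm_def, mul_assoc, annih_mul_annih b i, end_mul_neg, ← mul_assoc, ← mul_assoc]
  split_ifs with h
  · subst h
    rw [create_mul_annih_self, annih_mul_create_self]
    rw [sub_mul, one_mul]
    abel
  · rw [create_mul_annih h, end_neg_mul]
    abel

/-- The product of the two wedge signs counts particles above the larger index twice, so only those
strictly between remain. For `i < j` the particle at `j` is already removed when `i` is inserted. -/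
theorem matrixUnit_eq {i j : ℤ} (h : i ≠ j) (S : MayaDiagram) :
    matrixUnit i j S = (create i * annih j) (Finsupp.single S 1) := by
  classical
  rw [matrixUnit, if_neg h, create, annih]
  simp only [Module.End.mul_apply, occ_single, flip_single, MayaDiagram.mem_toggle]
  by_cases hj : j ∈ S.carrier
  · by_cases hi : i ∈ S.carrier
    · simp [hi, hj, h]
    · have hcar : S.move i j = (S.toggle j).toggle i := by
        ext t
        simp only [MayaDiagram.move, MayaDiagram.mem_toggle, Set.mem_insert_iff, Set.mem_sdiff,
          Set.mem_singleton_iff]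
        by_cases hti : t = i
        · subst hti; simp [hi, h]
        · simp only [hti, false_or, ne_eq, not_false_eq_true, iff_true]
          by_cases htj : t = j
          · subst htj; simp [hj]
          · simp [htj]
      rw [if_pos ⟨hj, hi⟩, hcar]
      simp only [hj, hi, h, ne_eq, not_false_eq_true, not_true_eq_false, if_true, one_mul, iff_true]
      congr 1
      rcases lt_or_gt_of_ne h with h' | h'
      · rw [min_eq_left h'.le, max_eq_right h'.le, wedgeSign_toggle_of_lt S h']
        have hset : {t : ℤ | t ∈ S.carrier ∧ i < t} =
            {t : ℤ | t ∈ S.carrier ∧ i < t ∧ t < j} ∪ insert j {t : ℤ | t ∈ S.carrier ∧ j < t} := by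
          ext t
          simp only [Set.mem_ofPred_eq, Set.mem_union, Set.mem_insert_iff]
          rcases lt_trichotomy t j with h1 | h1 | h1
          · simp [h1, h1.not_gt, h1.ne]
          · subst h1; simp [hj, h']
          · simp [h1, h1.not_gt, h1.ne', h'.trans h1]
        have hdisj : Disjoint {t : ℤ | t ∈ S.carrier ∧ i < t ∧ t < j}
            (insert j {t : ℤ | t ∈ S.carrier ∧ j < t}) := by
          rw [Set.disjoint_left]
          rintro t ⟨_, _, h1⟩ (h2 | ⟨_, h2⟩) <;> omega
        have hfin := (S.finite_gt i).subset (hset ▸ Set.subset_union_left)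
        rw [wedgeSign, wedgeSign, hset, Set.ncard_union_eq hdisj hfin ((S.finite_gt j).insert j),
          Set.ncard_insert_of_notMem (fun h => lt_irrefl _ h.2) (S.finite_gt j), pow_add, pow_succ]
        have := wedgeSign_mul_self S j
        rw [wedgeSign] at this
        linear_combination (-(-1) ^ Set.ncard {t : ℤ | t ∈ S.carrier ∧ i < t ∧ t < j}) * this
      · rw [min_eq_right h'.le, max_eq_left h'.le, wedgeSign_toggle_of_le S h'.le]
        have hset : {t : ℤ | t ∈ S.carrier ∧ j < t} =
            {t : ℤ | t ∈ S.carrier ∧ j < t ∧ t < i} ∪ {t : ℤ | t ∈ S.carrier ∧ i < t} := by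
          ext t
          simp only [Set.mem_ofPred_eq, Set.mem_union]
          rcases lt_trichotomy t i with h1 | h1 | h1
          · simp [h1, h1.not_gt]
          · subst h1; simp [hi]
          · simp [h1, h1.not_gt, h'.trans h1]
        have hdisj : Disjoint {t : ℤ | t ∈ S.carrier ∧ j < t ∧ t < i}
            {t : ℤ | t ∈ S.carrier ∧ i < t} := by
          rw [Set.disjoint_left]
          rintro t ⟨_, _, h1⟩ ⟨_, h2⟩
          omega
        have hfin := (S.finite_gt j).subset (hset ▸ Set.subset_union_left)
        rw [wedgeSign, wedgeSign, hset, Set.ncard_union_eq hdisj hfin (S.finite_gt i), pow_add]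
        have := wedgeSign_mul_self S i
        rw [wedgeSign] at this
        linear_combination (-(-1) ^ Set.ncard {t : ℤ | t ∈ S.carrier ∧ j < t ∧ t < i}) * this
  · simp [hj]

/-! ### Vacuum expectation values -/

open Classical in
theorem occ_apply (i : ℤ) (v : Fock) (T : MayaDiagram) :
    occ i v T = if i ∈ T.carrier then v T else 0 := by
  induction v using Finsupp.induction_linear with
  | zero => simp
  | add v w hv hw => rw [map_add, Finsupp.add_apply, hv, hw]; split_ifs <;> simp
  | single S c =>
    rw [occ_single]
    by_cases h : S = T
    · subst h; simp
    · simp [h]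

theorem mem_vacuum {i : ℤ} : i ∈ MayaDiagram.vacuum.carrier ↔ i < 0 := Iff.rfl

theorem create_apply_vacuum {i : ℤ} (hi : 0 ≤ i) (v : Fock) :
    create i v MayaDiagram.vacuum = 0 := by
  rw [create, Module.End.mul_apply, occ_apply, if_neg (by rw [mem_vacuum]; omega)]

theorem annih_apply_vacuum {i : ℤ} (hi : i < 0) (v : Fock) :
    annih i v MayaDiagram.vacuum = 0 := by
  rw [annih_eq, Module.End.mul_apply, LinearMap.sub_apply, Finsupp.sub_apply, occ_apply,
    if_pos (mem_vacuum.2 hi)]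
  simp

/-- The vacuum vector. -/
noncomputable def vac : Fock := Finsupp.single MayaDiagram.vacuum 1

theorem vac_apply : vac MayaDiagram.vacuum = 1 := by simp [vac]

theorem vev_eq (P : Module.End ℚ Fock) : vev P = P vac MayaDiagram.vacuum := rfl

theorem annih_vac {i : ℤ} (hi : 0 ≤ i) : annih i vac = 0 := by
  rw [annih, Module.End.mul_apply, vac, occ_single, if_neg (by rw [mem_vacuum]; omega)]
  simp

theorem create_vac {i : ℤ} (hi : i < 0) : create i vac = 0 := by
  rw [create_eq, Module.End.mul_apply, vac, LinearMap.sub_apply, occ_single,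
    if_pos (mem_vacuum.2 hi)]
  simp

/-- Composing with `flip` turns the hypotheses into eigenvalue equations for the occupation numbers,
which force every diagram in the support of `v` to be the vacuum. -/
theorem eq_smul_vac {v : Fock} (ha : ∀ i, 0 ≤ i → annih i v = 0)
    (hc : ∀ i, i < 0 → create i v = 0) : v = v MayaDiagram.vacuum • vac := by
  classical
  have key : ∀ T, T ≠ MayaDiagram.vacuum → v T = 0 := by
    intro T hT
    by_contra hv
    apply hT
    ext i
    rw [mem_vacuum]
    by_cases hi : i < 0
    · have h : (1 - occ i) v = 0 := by
        rw [← flip_mul_create, Module.End.mul_apply, hc i hi, map_zero]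
      have h2 := DFunLike.congr_fun h T
      rw [LinearMap.sub_apply, Finsupp.sub_apply, occ_apply] at h2
      simp only [hi, iff_true]
      by_contra hiT
      rw [if_neg hiT] at h2
      exact hv (by simpa using h2)
    · have h : occ i v = 0 := by
        rw [← flip_mul_annih, Module.End.mul_apply, ha i (by omega), map_zero]
      have h2 := DFunLike.congr_fun h T
      rw [occ_apply] at h2
      simp only [hi, iff_false]
      intro hiT
      rw [if_pos hiT] at h2
      exact hv (by simpa using h2)
  ext T
  by_cases hT : T = MayaDiagram.vacuum
  · subst hT; simp [vac_apply]
  · simp [key T hT, vac, Ne.symm hT]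

/-! ### Second quantization of one-particle operators -/

/-- `P` acts on fermions as the one-particle operator `∑ f(i) E_{i + d, i}`, that is, it is a second
quantization of it, up to an additive constant. -/
structure Implements (P : Module.End ℚ Fock) (d : ℤ) (f : Polynomial ℚ) : Prop where
  comm_create : ∀ i : ℤ, comm P (create i) = f.eval (i : ℚ) • create (i + d)
  comm_annih : ∀ i : ℤ, comm P (annih i) = -(f.eval ((i - d : ℤ) : ℚ)) • annih (i - d)

theorem Implements.smul {P : Module.End ℚ Fock} {d : ℤ} {f : Polynomial ℚ} (h : Implements P d f)
    (c : ℚ) : Implements (c • P) d (Polynomial.C c * f) where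
  comm_create i := by
    rw [smul_comm_left, h.comm_create, smul_smul, Polynomial.eval_C_mul]
  comm_annih i := by
    rw [smul_comm_left, h.comm_annih, smul_smul, Polynomial.eval_C_mul, mul_neg]

/-- By the Jacobi identity; the polynomial is that of the commutator of the two shift operators. The
unknown additive constants of `P` and `Q` are central and drop out. -/
theorem Implements.comm {P Q : Module.End ℚ Fock} {d e : ℤ} {f g : Polynomial ℚ}
    (hP : Implements P d f) (hQ : Implements Q e g) :
    Implements (comm P Q) (d + e) (f.comp (Polynomial.X + Polynomial.C (e : ℚ)) * g -
      g.comp (Polynomial.X + Polynomial.C (d : ℚ)) * f) where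
  comm_create i := by
    rw [comm_comm, hQ.comm_create, hP.comm_create, comm_smul_right, comm_smul_right, hQ.comm_create, hP.comm_create,
      smul_smul, smul_smul, show i + e + d = i + (d + e) by ring,
      show i + d + e = i + (d + e) by ring, ← sub_smul]
    congr 1
    simp only [Polynomial.eval_sub, Polynomial.eval_mul, Polynomial.eval_comp, Polynomial.eval_add,
      Polynomial.eval_X, Polynomial.eval_C]
    push_cast
    ring
  comm_annih i := by
    rw [comm_comm, hQ.comm_annih, hP.comm_annih, comm_smul_right, comm_smul_right, hQ.comm_annih, hP.comm_annih,
      smul_smul, smul_smul, show i - e - d = i - (d + e) by ring,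
      show i - d - e = i - (d + e) by ring, ← sub_smul]
    congr 1
    simp only [Polynomial.eval_sub, Polynomial.eval_mul, Polynomial.eval_comp, Polynomial.eval_add,
      Polynomial.eval_X, Polynomial.eval_C]
    push_cast
    ring_nf

/-- The coefficients of the one-particle operator behind `calE n r`. -/
noncomputable def calEPoly (n : ℤ) (r : ℕ) : Polynomial ℚ :=
  Polynomial.C (1 / (r ! : ℚ)) * (Polynomial.X + Polynomial.C (1 / 2 - (n : ℚ) / 2)) ^ r

/-- Stating this for every larger `L` lets two different vectors share one index set in the
commutator computation. -/
theorem calE_apply {n : ℤ} (hn : n ≠ 0) (r : ℕ) (v : Fock) :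
    ∃ L₀ : Finset ℤ, ∀ L, L₀ ⊆ L →
      calE n r v = ∑ l ∈ L, (calEPoly n r).eval (l : ℚ) • (create (l - n) * annih l) v := by
  induction v using Finsupp.induction_linear with
  | zero => exact ⟨∅, fun L _ => by simp⟩
  | add v w hv hw =>
    obtain ⟨L₁, h₁⟩ := hv
    obtain ⟨L₂, h₂⟩ := hw
    refine ⟨L₁ ∪ L₂, fun L hL => ?_⟩
    rw [map_add, h₁ L (Finset.union_subset_left hL), h₂ L (Finset.union_subset_right hL),
      ← Finset.sum_add_distrib]
    simp only [map_add, smul_add]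
  | single S c =>
    refine ⟨(matrixUnit_finite n S).toFinset, fun L hL => ?_⟩
    rw [calE, Finsupp.linearCombination_single, finsum_eq_sum_of_support_subset _ (s := L),
      Finset.smul_sum]
    · refine Finset.sum_congr rfl fun l _ => ?_
      rw [matrixUnit_eq (by omega), smul_comm, ← map_smul, Finsupp.smul_single, smul_eq_mul,
        mul_one]
      congr 1
      simp only [calEPoly, Polynomial.eval_mul, Polynomial.eval_C, Polynomial.eval_pow,
        Polynomial.eval_add, Polynomial.eval_X]
      rw [← add_sub_assoc]
      ring
    · intro l hl
      refine hL ?_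
      rw [Set.Finite.mem_toFinset]
      intro h
      exact hl (by simp [h])

theorem calE_implements {n : ℤ} (hn : n ≠ 0) (r : ℕ) :
    Implements (calE n r) (-n) (calEPoly n r) where
  comm_create i := by
    refine LinearMap.ext fun v => ?_
    obtain ⟨L₁, h₁⟩ := calE_apply hn r v
    obtain ⟨L₂, h₂⟩ := calE_apply hn r (create i v)
    -- Inserting `i` ensures that the only index with a nonzero commutator is present.
    have hL : L₁ ⊆ insert i (L₁ ∪ L₂) := fun x hx => by simp [hx]
    have hL' : L₂ ⊆ insert i (L₁ ∪ L₂) := fun x hx => by simp [hx]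
    rw [comm_def, LinearMap.sub_apply, Module.End.mul_apply, Module.End.mul_apply, h₁ _ hL,
      h₂ _ hL', map_sum, ← Finset.sum_sub_distrib]
    rw [Finset.sum_eq_single_of_mem i (by simp)]
    · rw [map_smul, ← smul_sub, ← Module.End.mul_apply, ← Module.End.mul_apply,
        ← LinearMap.sub_apply, ← comm_def, LeakyHurwitz.comm_create, if_pos rfl, ← sub_eq_add_neg,
        LinearMap.smul_apply]
    · intro l _ hl
      rw [map_smul, ← smul_sub, ← Module.End.mul_apply, ← Module.End.mul_apply,
        ← LinearMap.sub_apply, ← comm_def, LeakyHurwitz.comm_create, if_neg hl]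
      simp
  comm_annih i := by
    refine LinearMap.ext fun v => ?_
    obtain ⟨L₁, h₁⟩ := calE_apply hn r v
    obtain ⟨L₂, h₂⟩ := calE_apply hn r (annih i v)
    have hL : L₁ ⊆ insert (i + n) (L₁ ∪ L₂) := fun x hx => by simp [hx]
    have hL' : L₂ ⊆ insert (i + n) (L₁ ∪ L₂) := fun x hx => by simp [hx]
    rw [comm_def, LinearMap.sub_apply, Module.End.mul_apply, Module.End.mul_apply, h₁ _ hL,
      h₂ _ hL', map_sum, ← Finset.sum_sub_distrib]
    rw [Finset.sum_eq_single_of_mem (i + n) (by simp)]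
    · rw [map_smul, ← smul_sub, ← Module.End.mul_apply, ← Module.End.mul_apply,
        ← LinearMap.sub_apply, ← comm_def, LeakyHurwitz.comm_annih, if_pos (by ring), sub_neg_eq_add,
        LinearMap.smul_apply]
      simp
    · intro l _ hl
      rw [map_smul, ← smul_sub, ← Module.End.mul_apply, ← Module.End.mul_apply,
        ← LinearMap.sub_apply, ← comm_def, LeakyHurwitz.comm_annih, if_neg (by omega)]
      simp

/-- For each term, either `l < 0` and `annih l`, moved to the left, kills the vacuum covector, or `l
- n ≥ 0` and `create (l - n)` does. -/
theorem calE_apply_vacuum {n : ℤ} (hn : n < 0) (r : ℕ) (v : Fock) :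
    calE n r v MayaDiagram.vacuum = 0 := by
  obtain ⟨L, hL⟩ := calE_apply hn.ne r v
  rw [hL L subset_rfl, Finsupp.finsetSum_apply]
  refine Finset.sum_eq_zero fun l _ => ?_
  rw [Finsupp.smul_apply]
  by_cases hl : l < 0
  · rw [create_mul_annih (by omega), LinearMap.neg_apply, Finsupp.neg_apply, Module.End.mul_apply,
      annih_apply_vacuum hl]
    simp
  · rw [Module.End.mul_apply, create_apply_vacuum (by omega), smul_zero]

/-- The commutators with fermions show that `Q vac` minus the sum satisfies the equations
characterizing multiples of `vac`. The range consists of the occupied `j < 0` sent to an empty `j +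
e ≥ 0`; the constant is the additive ambiguity of `Q`. -/
theorem Implements.apply_vac {Q : Module.End ℚ Fock} {e : ℤ} {g : Polynomial ℚ}
    (hQ : Implements Q e g) : ∃ c : ℚ, Q vac = c • vac +
      ∑ j ∈ Finset.Ico (-e) 0, g.eval (j : ℚ) • (create (j + e) * annih j) vac := by
  refine ⟨_, eq_add_of_sub_eq (eq_smul_vac (fun i hi => ?_) (fun i hi => ?_))⟩
  · have h1 : annih i (Q vac) = g.eval ((i - e : ℤ) : ℚ) • annih (i - e) vac := by
      have := congrArg (fun T => T vac) (hQ.comm_annih i)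
      simp only [comm_def, LinearMap.sub_apply, Module.End.mul_apply, annih_vac hi, map_zero,
        zero_sub, LinearMap.smul_apply, neg_smul] at this
      exact neg_injective this
    rw [map_sub, map_sum, h1, sub_eq_zero]
    have h2 : ∀ j : ℤ, annih i ((create (j + e) * annih j) vac) =
        if j + e = i then annih j vac else 0 := by
      intro j
      have := congrArg (fun T => T vac) (LeakyHurwitz.comm_annih (j + e) j i)
      simp only [comm_def, LinearMap.sub_apply, Module.End.mul_apply, annih_vac hi, map_zero,
        zero_sub] at this
      rw [Module.End.mul_apply, ← neg_eq_iff_eq_neg.2 this.symm]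
      split_ifs <;> simp
    simp only [map_smul, h2]
    by_cases hie : i - e < 0
    · rw [Finset.sum_eq_single_of_mem (i - e) (by simp; omega)]
      · simp
      · intro j _ hj
        rw [if_neg (by omega), smul_zero]
    · rw [annih_vac (by omega), smul_zero]
      symm
      refine Finset.sum_eq_zero fun j hj => ?_
      rw [Finset.mem_Ico] at hj
      rw [if_neg (by omega), smul_zero]
  · have h1 : create i (Q vac) = -(g.eval (i : ℚ) • create (i + e) vac) := by
      have := congrArg (fun T => T vac) (hQ.comm_create i)
      simp only [comm_def, LinearMap.sub_apply, Module.End.mul_apply, create_vac hi, map_zero,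
        zero_sub, LinearMap.smul_apply] at this
      rw [← this, neg_neg]
    rw [map_sub, map_sum, h1, sub_eq_zero]
    have h2 : ∀ j : ℤ, create i ((create (j + e) * annih j) vac) =
        if j = i then -create (j + e) vac else 0 := by
      intro j
      have := congrArg (fun T => T vac) (LeakyHurwitz.comm_create (j + e) j i)
      simp only [comm_def, LinearMap.sub_apply, Module.End.mul_apply, create_vac hi, map_zero,
        zero_sub] at this
      rw [Module.End.mul_apply, ← neg_eq_iff_eq_neg.2 this.symm]
      split_ifs <;> simp
    simp only [map_smul, h2]
    by_cases hie : 0 ≤ i + e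
    · rw [Finset.sum_eq_single_of_mem i (by simp; omega)]
      · simp
      · intro j _ hj
        rw [if_neg hj, smul_zero]
    · rw [create_vac (by omega), smul_zero, neg_zero]
      symm
      refine Finset.sum_eq_zero fun j hj => ?_
      rw [Finset.mem_Ico] at hj
      rw [if_neg (by omega), smul_zero]

/-- The connected two-point function of second quantized operators. -/
theorem Implements.vev_mul_sub {P Q : Module.End ℚ Fock} {d e : ℤ} {f g : Polynomial ℚ}
    (hP : Implements P d f) (hQ : Implements Q e g) :
    vev (P * Q) - vev P * vev Q =
      if d + e = 0 then ∑ j ∈ Finset.Ico (-e) 0, g.eval (j : ℚ) * f.eval ((j + e : ℤ) : ℚ)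
      else 0 := by
  obtain ⟨c, hc⟩ := hQ.apply_vac
  have hvac : ∀ j ∈ Finset.Ico (-e) 0,
      (create (j + e) * annih j) vac MayaDiagram.vacuum = 0 := by
    intro j hj
    rw [Finset.mem_Ico] at hj
    rw [Module.End.mul_apply, create_apply_vacuum (by omega)]
  have hPvac : ∀ j ∈ Finset.Ico (-e) 0,
      P ((create (j + e) * annih j) vac) MayaDiagram.vacuum =
        if d + e = 0 then f.eval ((j + e : ℤ) : ℚ) else 0 := by
    intro j hj
    rw [Finset.mem_Ico] at hj
    -- To the left of `P`, `create (j + e)` is killed by the vacuum covector, so only the commutator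
    -- term survives; it returns to the vacuum exactly when `j + e + d = j`.
    have h1 : P * create (j + e) = create (j + e) * P + f.eval ((j + e : ℤ) : ℚ) • create (j + e + d) := by
      rw [← hP.comm_create, comm_def]
      abel
    rw [← Module.End.mul_apply, ← mul_assoc, h1, add_mul, LinearMap.add_apply, Finsupp.add_apply,
      mul_assoc, Module.End.mul_apply, create_apply_vacuum (by omega), zero_add, smul_mul_assoc,
      LinearMap.smul_apply, Finsupp.smul_apply]
    split_ifs with h
    · rw [show j + e + d = j by omega, create_mul_annih_self, occ_apply, if_pos (mem_vacuum.2 hj.2),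
        vac_apply, smul_eq_mul, mul_one]
    · rw [create_mul_annih (by omega), LinearMap.neg_apply, Finsupp.neg_apply, Module.End.mul_apply,
        annih_apply_vacuum hj.2]
      simp
  have hQ0 : vev Q = c := by
    rw [vev_eq, hc, Finsupp.add_apply, Finsupp.smul_apply, vac_apply, Finsupp.finsetSum_apply,
      Finset.sum_eq_zero]
    · simp
    · intro j hj
      rw [Finsupp.smul_apply, hvac j hj, smul_zero]
  have hPQ : vev (P * Q) = c * vev P +
      ∑ j ∈ Finset.Ico (-e) 0, if d + e = 0 then g.eval (j : ℚ) * f.eval ((j + e : ℤ) : ℚ) else 0 := by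
    rw [vev_eq, Module.End.mul_apply, hc, map_add, map_smul, map_sum, Finsupp.add_apply,
      Finsupp.finsetSum_apply, Finsupp.smul_apply, ← vev_eq, smul_eq_mul]
    congr 1
    refine Finset.sum_congr rfl fun j hj => ?_
    rw [map_smul, Finsupp.smul_apply, hPvac j hj]
    split_ifs <;> simp
  rw [hPQ, hQ0]
  split_ifs <;> simp <;> ring

/-! ### Divided powers of commutators -/

/-- `(ad X) ^ n P / n!`, up to sign: the coefficient of `u ^ n` in `exp (-u X) P exp (u X)`. -/
noncomputable def divComm (X : Module.End ℚ Fock) : ℕ → Module.End ℚ Fock → Module.End ℚ Fock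
  | 0, P => P
  | n + 1, P => (1 / ((n : ℚ) + 1)) • comm (divComm X n P) X

theorem comm_divComm (X : Module.End ℚ Fock) (n : ℕ) (P : Module.End ℚ Fock) :
    comm (divComm X n P) X = ((n : ℚ) + 1) • divComm X (n + 1) P := by
  rw [divComm, smul_smul, mul_one_div_cancel (by positivity), one_smul]

theorem comm_sum {ι : Type*} (s : Finset ι) (F : ι → Module.End ℚ Fock) (X : Module.End ℚ Fock) :
    comm (∑ i ∈ s, F i) X = ∑ i ∈ s, comm (F i) X := by
  simp only [comm, Finset.sum_mul, Finset.mul_sum, ← Finset.sum_sub_distrib]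

theorem comm_mul (P Q X : Module.End ℚ Fock) :
    comm (P * Q) X = comm P X * Q + P * comm Q X := by
  simp only [comm, sub_mul, mul_sub, mul_assoc]
  abel

theorem divComm_add (X : Module.End ℚ Fock) (n : ℕ) (P Q : Module.End ℚ Fock) :
    divComm X n (P + Q) = divComm X n P + divComm X n Q := by
  induction n with
  | zero => rfl
  | succ n ih =>
    rw [divComm, divComm, divComm, ih, ← smul_add]
    congr 1
    simp only [comm, add_mul, mul_add]
    abel

theorem divComm_zero (X : Module.End ℚ Fock) (n : ℕ) : divComm X n 0 = 0 := by
  induction n with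
  | zero => rfl
  | succ n ih => rw [divComm, ih, comm]; simp

theorem divComm_sum {ι : Type*} (s : Finset ι) (F : ι → Module.End ℚ Fock)
    (X : Module.End ℚ Fock) (n : ℕ) :
    divComm X n (∑ i ∈ s, F i) = ∑ i ∈ s, divComm X n (F i) := by
  classical
  induction s using Finset.induction_on with
  | empty => simp [divComm_zero]
  | insert a s ha ih => rw [Finset.sum_insert ha, Finset.sum_insert ha, divComm_add, ih]

theorem divComm_mul (X : Module.End ℚ Fock) (n : ℕ) (P Q : Module.End ℚ Fock) :
    divComm X n (P * Q) =
      ∑ p ∈ antidiagonal n, divComm X p.1 P * divComm X p.2 Q := by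
  induction n with
  | zero => simp [divComm]
  | succ n ih =>
    -- The weights `p.1` and `p.2` record the derivative falling on either factor; they add up to `n
    -- + 1`, cancelling the divided-power denominator.
    have h1 : ∑ p ∈ antidiagonal (n + 1), (p.1 : ℚ) • (divComm X p.1 P * divComm X p.2 Q) =
        ∑ p ∈ antidiagonal n, comm (divComm X p.1 P) X * divComm X p.2 Q := by
      rw [Finset.Nat.sum_antidiagonal_succ]
      simp only [Nat.cast_zero, zero_smul, zero_add, comm_divComm, smul_mul_assoc, Nat.cast_add,
        Nat.cast_one]
    have h2 : ∑ p ∈ antidiagonal (n + 1), (p.2 : ℚ) • (divComm X p.1 P * divComm X p.2 Q) =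
        ∑ p ∈ antidiagonal n, divComm X p.1 P * comm (divComm X p.2 Q) X := by
      rw [Finset.Nat.sum_antidiagonal_succ']
      simp only [Nat.cast_zero, zero_smul, zero_add, comm_divComm, mul_smul_comm, Nat.cast_add,
        Nat.cast_one]
    rw [divComm, ih, comm_sum]
    simp only [comm_mul]
    rw [Finset.sum_add_distrib, ← h1, ← h2, ← Finset.sum_add_distrib, Finset.smul_sum]
    refine Finset.sum_congr rfl fun p hp => ?_
    rw [HasAntidiagonal.mem_antidiagonal] at hp
    rw [← add_smul, smul_smul, ← Nat.cast_add, hp]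
    push_cast
    rw [one_div_mul_cancel (by positivity), one_smul]

/-- As `X` vanishes at the left end, each factor `X` may be replaced by a commutator, which raises
`i`; hence the induction over general `i`. -/
theorem vev_mul_pow_mul {X : Module.End ℚ Fock} (hX : ∀ v, X v MayaDiagram.vacuum = 0) (b i : ℕ)
    (P Z : Module.End ℚ Fock) :
    (i ! : ℚ) * vev (divComm X i P * X ^ b * Z) = ((i + b)! : ℚ) * vev (divComm X (i + b) P * Z) := by
  induction b generalizing i with
  | zero => simp
  | succ b ih =>
    have h : divComm X i P * X ^ (b + 1) * Z =
        X * (divComm X i P * X ^ b * Z) + ((i : ℚ) + 1) • (divComm X (i + 1) P * X ^ b * Z) := by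
      rw [← smul_mul_assoc, ← smul_mul_assoc, ← comm_divComm, comm, pow_succ', sub_mul, sub_mul]
      simp only [mul_assoc]
      abel
    have h2 : vev (divComm X i P * X ^ (b + 1) * Z) =
        ((i : ℚ) + 1) * vev (divComm X (i + 1) P * X ^ b * Z) := by
      rw [h, vev_eq, LinearMap.add_apply, Finsupp.add_apply, Module.End.mul_apply, hX, zero_add]
      rfl
    have := ih (i + 1)
    rw [Nat.factorial_succ, show i + 1 + b = i + (b + 1) by ring] at this
    rw [h2, ← this]
    push_cast
    ring

theorem vev_mul_pow_mul_pow {X Y : Module.End ℚ Fock} (hX : ∀ v, X v MayaDiagram.vacuum = 0)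
    (hY : ∀ v, Y v MayaDiagram.vacuum = 0) (b n : ℕ) (P : Module.End ℚ Fock) :
    vev (P * X ^ b * Y ^ n) = (b ! : ℚ) * (n ! : ℚ) * vev (divComm Y n (divComm X b P)) := by
  have h1 := vev_mul_pow_mul hX b 0 P (Y ^ n)
  have h2 := vev_mul_pow_mul hY n 0 (divComm X b P) 1
  simp only [Nat.factorial_zero, Nat.cast_one, one_mul, zero_add, mul_one] at h1 h2
  change vev (P * X ^ b * Y ^ n) = _ at h1
  change vev (divComm X b P * Y ^ n) = _ at h2
  rw [h1, h2, mul_assoc]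

theorem vev_sum {ι : Type*} (s : Finset ι) (F : ι → Module.End ℚ Fock) :
    vev (∑ i ∈ s, F i) = ∑ i ∈ s, vev (F i) := by
  simp only [vev_eq, LinearMap.sum_apply, Finsupp.finsetSum_apply]

/-! ### Symbols of one-particle operators -/

/-- `f` is `c x ^ d` plus terms of lower degree. -/
def HasSymbol (f : Polynomial ℚ) (d : ℕ) (c : ℚ) : Prop := f.natDegree ≤ d ∧ f.coeff d = c

theorem HasSymbol.eq_C {f : Polynomial ℚ} {c : ℚ} (h : HasSymbol f 0 c) : f = Polynomial.C c := by
  rw [Polynomial.eq_C_of_natDegree_le_zero h.1, h.2]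

theorem HasSymbol.mul {f g : Polynomial ℚ} {d e : ℕ} {a b : ℚ} (hf : HasSymbol f d a)
    (hg : HasSymbol g e b) : HasSymbol (f * g) (d + e) (a * b) :=
  ⟨Polynomial.natDegree_mul_le_of_le hf.1 hg.1, by
    rw [Polynomial.coeff_mul_add_eq_of_natDegree_le hf.1 hg.1, hf.2, hg.2]⟩

theorem HasSymbol.sub {f g : Polynomial ℚ} {d : ℕ} {a b : ℚ} (hf : HasSymbol f d a)
    (hg : HasSymbol g d b) : HasSymbol (f - g) d (a - b) :=
  ⟨(Polynomial.natDegree_sub_le _ _).trans (max_le hf.1 hg.1), by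
    rw [Polynomial.coeff_sub, hf.2, hg.2]⟩

theorem HasSymbol.C (c : ℚ) : HasSymbol (Polynomial.C c) 0 c :=
  ⟨(Polynomial.natDegree_C c).le, Polynomial.coeff_C_zero⟩

theorem HasSymbol.X_add_C_pow (a : ℚ) (n : ℕ) :
    HasSymbol ((Polynomial.X + Polynomial.C a) ^ n) n 1 :=
  ⟨by rw [Polynomial.natDegree_pow, Polynomial.natDegree_X_add_C, mul_one], by
    rw [Polynomial.coeff_X_add_C_pow]; simp⟩

theorem HasSymbol.shift_sub {f : Polynomial ℚ} {d : ℕ} {c : ℚ} (h : HasSymbol f (d + 1) c) (a : ℚ) :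
    HasSymbol (f.comp (Polynomial.X + Polynomial.C a) - f) d (((d : ℚ) + 1) * a * c) := by
  have hco : ∀ N, (f.comp (Polynomial.X + Polynomial.C a)).coeff N =
      ∑ i ∈ Finset.range (d + 2), f.coeff i * (a ^ (i - N) * (i.choose N : ℚ)) := by
    intro N
    rw [Polynomial.comp_eq_sum_left, Polynomial.sum_over_range' _ (by simp) (d + 2)
      (Nat.lt_succ_of_le h.1), Polynomial.finsetSum_coeff]
    refine Finset.sum_congr rfl fun i _ => ?_
    rw [Polynomial.coeff_C_mul, Polynomial.coeff_X_add_C_pow]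
  constructor
  · rw [Polynomial.natDegree_le_iff_coeff_eq_zero]
    intro N hN
    rw [Polynomial.coeff_sub, hco, Finset.sum_range_succ, Finset.sum_eq_zero, zero_add]
    · rcases eq_or_lt_of_le (Nat.succ_le_of_lt hN) with rfl | hN'
      · simp
      · rw [Nat.choose_eq_zero_of_lt hN',
          Polynomial.coeff_eq_zero_of_natDegree_lt (lt_of_le_of_lt h.1 hN')]
        simp
    · intro i hi
      rw [Finset.mem_range] at hi
      rw [Nat.choose_eq_zero_of_lt (by omega)]
      simp
  · rw [Polynomial.coeff_sub, hco, Finset.sum_range_succ, Finset.sum_range_succ,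
      Finset.sum_eq_zero, zero_add, h.2]
    · simp
      ring
    · intro i hi
      rw [Finset.mem_range] at hi
      rw [Nat.choose_eq_zero_of_lt (by omega)]
      simp

/-- Subtracting and adding `f * g` leaves two finite differences, so the top-degree products cancel
and the degree drops by one. -/
theorem HasSymbol.shift_sub_mul {f g : Polynomial ℚ} {d r : ℕ} {a c : ℚ} (hf : HasSymbol f d a)
    (hg : HasSymbol g (r + 1) c) (k e : ℚ) :
    HasSymbol (f.comp (Polynomial.X + Polynomial.C k) * g -
      g.comp (Polynomial.X + Polynomial.C e) * f) (d + r) (a * c * (d * k - (r + 1) * e)) := by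
  have h2 := (hg.shift_sub e).mul hf
  have h1 : HasSymbol ((f.comp (Polynomial.X + Polynomial.C k) - f) * g) (d + r) (d * k * a * c) := by
    -- Degree zero is outside `shift_sub`; there the difference of `f` is zero, matching the factor
    -- `d`.
    cases d with
    | zero =>
      rw [hf.eq_C]
      simp [HasSymbol]
    | succ d =>
      have := (hf.shift_sub k).mul hg
      rw [show d + (r + 1) = d + 1 + r by ring] at this
      simpa using this
  rw [add_comm r d] at h2
  convert h1.sub h2 using 1
  · ring
  · ring

theorem hasSymbol_calEPoly (n : ℤ) (r : ℕ) : HasSymbol (calEPoly n r) r (1 / (r ! : ℚ)) := by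
  have := (HasSymbol.C (1 / (r ! : ℚ))).mul (HasSymbol.X_add_C_pow (1 / 2 - (n : ℚ) / 2) r)
  rwa [zero_add, mul_one] at this

theorem Implements.congr {P : Module.End ℚ Fock} {d e : ℤ} {f : Polynomial ℚ}
    (h : Implements P d f) (hde : d = e) : Implements P e f := hde ▸ h

theorem Implements.vev_mul_sub_eq_zero {P Q : Module.End ℚ Fock} {d e : ℤ} {f g : Polynomial ℚ}
    (hP : Implements P d f) (hQ : Implements Q e g) (h : f = 0 ∨ g = 0) :
    vev (P * Q) - vev P * vev Q = 0 := by
  rw [hP.vev_mul_sub hQ]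
  split_ifs
  · rcases h with rfl | rfl <;> simp
  · rfl

/-! ### Binomial coefficients -/

theorem choose_succ_mul (x : ℚ) (n : ℕ) :
    Ring.choose x (n + 1) * ((n : ℚ) + 1) = Ring.choose x n * (x - n) := by
  have := Ring.choose_smul_choose x (Nat.le_succ n)
  simp at this
  linarith

theorem mul_choose_sub_one (x : ℚ) (n : ℕ) :
    x * Ring.choose (x - 1) n = (x - n) * Ring.choose x n := by
  have h := Ring.choose_smul_choose x (Nat.le_add_left 1 n)
  have h2 := choose_succ_mul x n
  simp at h
  linarith

/-- A telescoping sum, by induction on `t`. It will be used with `c = B / A` and `t = ⌊l / B⌋`. -/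
theorem sum_sub_mul_choose_mul_choose {x y c : ℚ} {b : ℕ} (h : x + y = b * c) (t : ℕ)
    (ht : t ≤ b) :
    (b : ℚ) * ∑ i ∈ Finset.range (t + 1), (x - c * i) * Ring.choose x i * Ring.choose y (b - i) =
      ((x - t) * Ring.choose x t) * (((b : ℚ) - t) * Ring.choose y (b - t)) := by
  induction t with
  | zero => simp; ring
  | succ t ih =>
    rw [Finset.sum_range_succ, mul_add, ih (by omega)]
    obtain ⟨j, rfl⟩ : ∃ j, b = t + 1 + j := ⟨b - (t + 1), by omega⟩
    rw [show t + 1 + j - t = j + 1 by omega, show t + 1 + j - (t + 1) = j by omega]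
    have h1 := choose_succ_mul x t
    have h2 := choose_succ_mul y j
    push_cast at h ⊢
    have h3 : ((t : ℚ) + 1 + j - t) * Ring.choose y (j + 1) = Ring.choose y j * (y - j) := by
      rw [← h2]; ring
    have h4 : (x - t) * Ring.choose x t = Ring.choose x (t + 1) * ((t : ℚ) + 1) := by
      rw [h1]; ring
    rw [h3, h4]
    linear_combination (Ring.choose x (t + 1) * Ring.choose y j * (t + 1)) * h

/-! ### The two-point function in genus zero -/

section TwoPoint

variable {k r q : ℕ}

/-- The operator `F_r^k / r`. -/
noncomputable abbrev cutJoin (k r : ℕ) : Module.End ℚ Fock := (1 / (r : ℚ)) • leakyF (k : ℤ) r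

/-- The operator `J_{-q} / q`. -/
noncomputable abbrev orbifoldJ (q : ℕ) : Module.End ℚ Fock := (1 / (q : ℚ)) • J (-(q : ℤ))

theorem cutJoin_implements (hk : 1 ≤ k) :
    ∃ g, Implements (cutJoin k r) k g ∧ HasSymbol g r (1 / (r : ℚ)) := by
  have h := ((calE_implements (n := -(k : ℤ)) (by omega) r).smul (r ! : ℚ)).smul (1 / (r : ℚ))
  rw [neg_neg] at h
  refine ⟨_, h, ?_⟩
  have := (HasSymbol.C (1 / (r : ℚ))).mul
    ((HasSymbol.C (r ! : ℚ)).mul (hasSymbol_calEPoly (-(k : ℤ)) r))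
  rw [mul_one_div_cancel (by positivity), mul_one, zero_add, zero_add] at this
  exact this

theorem cutJoin_apply_vacuum (hk : 1 ≤ k) (v : Fock) :
    cutJoin k r v MayaDiagram.vacuum = 0 := by
  rw [cutJoin, leakyF, LinearMap.smul_apply, LinearMap.smul_apply, Finsupp.smul_apply,
    Finsupp.smul_apply, calE_apply_vacuum (by omega)]
  simp

theorem J_implements {n : ℤ} (hn : n ≠ 0) : Implements (J n) (-n) (Polynomial.C 1) := by
  have h := calE_implements hn 0
  rwa [show calEPoly n 0 = Polynomial.C 1 by simp [calEPoly]] at h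

theorem orbifoldJ_implements (hq : 1 ≤ q) :
    Implements (orbifoldJ q) q (Polynomial.C (1 / (q : ℚ))) := by
  have h := (J_implements (n := -(q : ℤ)) (by omega)).smul (1 / (q : ℚ))
  rwa [neg_neg, ← Polynomial.C_mul, mul_one] at h

theorem orbifoldJ_apply_vacuum (hq : 1 ≤ q) (v : Fock) :
    orbifoldJ q v MayaDiagram.vacuum = 0 := by
  rw [orbifoldJ, J, LinearMap.smul_apply, Finsupp.smul_apply, calE_apply_vacuum (by omega)]
  simp

/-- Each step multiplies the symbol by (l - bA)/(b+1) = A(l/A - b)/(b+1), the recursion of A^b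
binom(l/A, b). -/
theorem divComm_cutJoin_implements (hk : 1 ≤ k) (hr : 1 ≤ r) {l : ℕ} (hl : 1 ≤ l) (b : ℕ) :
    ∃ f, Implements (divComm (cutJoin k r) b (J l)) (-(l : ℤ) + k * b) f ∧
      HasSymbol f (b * (r - 1))
        (((k : ℚ) / r) ^ b * Ring.choose ((l : ℚ) / ((k : ℚ) / r)) b) := by
  obtain ⟨g, hg, hgs⟩ := cutJoin_implements (r := r) hk
  obtain ⟨r, rfl⟩ : ∃ s, r = s + 1 := ⟨r - 1, by omega⟩
  rw [Nat.add_sub_cancel]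
  induction b with
  | zero =>
    refine ⟨_, (J_implements (n := l) (by omega)).congr (by simp), ?_⟩
    simpa using HasSymbol.C 1
  | succ b ih =>
    obtain ⟨f, hf, hfs⟩ := ih
    refine ⟨_, ((hf.comm hg).smul _).congr (by push_cast; ring), ?_⟩
    have h := (HasSymbol.C (1 / ((b : ℚ) + 1))).mul
      (hfs.shift_sub_mul hgs ((k : ℤ) : ℚ) ((-(l : ℤ) + k * b : ℤ) : ℚ))
    have hc := choose_succ_mul ((l : ℚ) / ((k : ℚ) / ((r + 1 : ℕ) : ℚ))) b
    have hk' : (k : ℚ) ≠ 0 := by positivity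
    have hr' : (r : ℚ) + 1 ≠ 0 := by positivity
    have hb' : (b : ℚ) + 1 ≠ 0 := by positivity
    rw [← eq_div_iff hb'] at hc
    convert h using 1
    · ring
    · rw [hc, pow_succ]
      push_cast
      field_simp
      ring

/-- Commuting with `orbifoldJ q` is the difference quotient of step `q`; with the divided powers, n
steps act on the top coefficient as the n-th derivative over n!. -/
theorem divComm_orbifoldJ_implements (hq : 1 ≤ q) {P : Module.End ℚ Fock} {e : ℤ}
    {f : Polynomial ℚ} {d : ℕ} {c : ℚ} (hP : Implements P e f) (hf : HasSymbol f d c) (n : ℕ) :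
    ∃ g, Implements (divComm (orbifoldJ q) n P) (e + q * n) g ∧
      (n ≤ d → HasSymbol g (d - n) (d.choose n * c)) ∧ (d < n → g = 0) := by
  induction n with
  | zero => exact ⟨f, hP.congr (by simp), fun _ => by simpa using hf, fun h => by omega⟩
  | succ n ih =>
    obtain ⟨g, hg, h1, h2⟩ := ih
    refine ⟨_, ((hg.comm (orbifoldJ_implements hq)).smul _).congr (by push_cast; ring), ?_, ?_⟩
    · intro hn
      have hs := h1 (by omega)
      obtain ⟨j, rfl⟩ : ∃ j, d = n + (j + 1) := ⟨d - (n + 1), by omega⟩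
      rw [Nat.add_sub_cancel_left] at hs
      rw [show n + (j + 1) - (n + 1) = j by omega]
      have := (HasSymbol.C (1 / ((n : ℚ) + 1))).mul
        ((hs.shift_sub ((q : ℤ) : ℚ)).mul (HasSymbol.C (1 / (q : ℚ))))
      rw [zero_add, add_zero] at this
      have hch : ((n + (j + 1)).choose (n + 1) : ℚ) * ((n : ℚ) + 1) =
          ((n + (j + 1)).choose n : ℚ) * ((j : ℚ) + 1) := by
        have := Nat.choose_succ_right_eq (n + (j + 1)) n
        rw [Nat.add_sub_cancel_left] at this
        exact_mod_cast this
      have hq' : (q : ℚ) ≠ 0 := by positivity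
      have hn' : (n : ℚ) + 1 ≠ 0 := by positivity
      rw [← eq_div_iff hn'] at hch
      convert this using 1
      · rw [Polynomial.C_comp]; ring
      · rw [hch]
        push_cast
        field_simp
    · intro hn
      have hC : ∃ a, g = Polynomial.C a := by
        rcases Nat.lt_succ_iff_lt_or_eq.1 hn with h | rfl
        · exact ⟨0, by rw [h2 h, Polynomial.C_0]⟩
        · have := h1 le_rfl
          rw [Nat.sub_self] at this
          exact ⟨_, this.eq_C⟩
      obtain ⟨a, rfl⟩ := hC
      rw [Polynomial.C_comp, Polynomial.C_comp, mul_comm (Polynomial.C a), sub_self, mul_zero]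

/-- The coefficient of `β ^ b s ^ n` in `J_l` conjugated by
`exp (β F_r^k / r) exp (s J_{-q} / q)`. -/
noncomputable def conjJ (k r q l b n : ℕ) : Module.End ℚ Fock :=
  divComm (orbifoldJ q) n (divComm (cutJoin k r) b (J l))

theorem conjJ_implements (hk : 1 ≤ k) (hr : 1 ≤ r) (hq : 1 ≤ q) {l : ℕ} (hl : 1 ≤ l) (b n : ℕ) :
    ∃ g, Implements (conjJ k r q l b n) (-(l : ℤ) + k * b + q * n) g ∧
      (n = b * (r - 1) → g = Polynomial.C
        (((k : ℚ) / r) ^ b * Ring.choose ((l : ℚ) / ((k : ℚ) / r)) b)) ∧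
      (b * (r - 1) < n → g = 0) := by
  obtain ⟨f, hf, hfs⟩ := divComm_cutJoin_implements hk hr hl b
  obtain ⟨g, hg, h1, h2⟩ := divComm_orbifoldJ_implements hq hf hfs n
  refine ⟨g, hg, fun h => ?_, h2⟩
  subst h
  have := h1 le_rfl
  rw [Nat.sub_self] at this
  rw [this.eq_C, Nat.choose_self, Nat.cast_one, one_mul]

/-! ### Coefficients of the connected two-point function -/

theorem coeff_disconnected_singleton (hk : 1 ≤ k) (hq : 1 ≤ q) (l b n : ℕ) :
    PowerSeries.coeff n (PowerSeries.coeff b (disconnected k r q [l])) =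
      1 / (l : ℚ) * vev (conjJ k r q l b n) := by
  rw [disconnected, PowerSeries.coeff_mk, PowerSeries.coeff_mk]
  change 1 / (((l : ℚ) * 1) * (b ! : ℚ) * (n ! : ℚ)) *
    vev ((J l * 1) * cutJoin k r ^ b * orbifoldJ q ^ n) = _
  rw [mul_one, mul_one]
  rw [vev_mul_pow_mul_pow (cutJoin_apply_vacuum hk) (orbifoldJ_apply_vacuum hq), ← conjJ]
  have hb : (b ! : ℚ) ≠ 0 := by positivity
  have hn : (n ! : ℚ) ≠ 0 := by positivity
  field_simp

theorem coeff_disconnected_pair (hk : 1 ≤ k) (hq : 1 ≤ q) (l m b n : ℕ) :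
    PowerSeries.coeff n (PowerSeries.coeff b (disconnected k r q [l, m])) =
      1 / ((l : ℚ) * m) * ∑ i ∈ antidiagonal b, ∑ j ∈ antidiagonal n,
        vev (conjJ k r q l i.1 j.1 * conjJ k r q m i.2 j.2) := by
  rw [disconnected, PowerSeries.coeff_mk, PowerSeries.coeff_mk]
  change 1 / (((l : ℚ) * ((m : ℚ) * 1)) * (b ! : ℚ) * (n ! : ℚ)) *
    vev ((J l * (J m * 1)) * cutJoin k r ^ b * orbifoldJ q ^ n) = _
  rw [mul_one, mul_one]
  rw [vev_mul_pow_mul_pow (cutJoin_apply_vacuum hk) (orbifoldJ_apply_vacuum hq), divComm_mul,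
    divComm_sum, vev_sum]
  simp only [divComm_mul, vev_sum]
  have hb : (b ! : ℚ) ≠ 0 := by positivity
  have hn : (n ! : ℚ) ≠ 0 := by positivity
  simp only [conjJ]
  field_simp

theorem connected_pair (l m : ℕ) :
    connected k r q ![l, m] =
      disconnected k r q [l, m] - disconnected k r q [l] * disconnected k r q [m] := by
  have huniv : (Finset.univ : Finset (Finpartition (Finset.univ : Finset (Fin 2)))) = {⊤, ⊥} := by
    decide
  have htop : (⊤ : Finpartition (Finset.univ : Finset (Fin 2))).parts = {{0, 1}} := by decide
  have hbot : (⊥ : Finpartition (Finset.univ : Finset (Fin 2))).parts = {{0}, {1}} := by decide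
  have hsort : ({0, 1} : Finset (Fin 2)).sort (· ≤ ·) = [0, 1] := by simp [Finset.sort_insert]
  rw [connected, huniv, Finset.sum_pair (by decide), htop, hbot, Finset.prod_singleton,
    Finset.prod_pair (by decide), hsort]
  simp [sub_eq_add_neg]

theorem coeff_connected (hk : 1 ≤ k) (hq : 1 ≤ q) (l m b n : ℕ) :
    PowerSeries.coeff n (PowerSeries.coeff b (connected k r q ![l, m])) =
      1 / ((l : ℚ) * m) * ∑ i ∈ antidiagonal b, ∑ j ∈ antidiagonal n,
        (vev (conjJ k r q l i.1 j.1 * conjJ k r q m i.2 j.2) -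
          vev (conjJ k r q l i.1 j.1) * vev (conjJ k r q m i.2 j.2)) := by
  rw [connected_pair, map_sub, map_sub, coeff_disconnected_pair hk hq, PowerSeries.coeff_mul,
    map_sum]
  simp only [PowerSeries.coeff_mul, coeff_disconnected_singleton hk hq, Finset.sum_sub_distrib,
    mul_sub, Finset.mul_sum]
  congr 1
  refine Finset.sum_congr rfl fun i _ => Finset.sum_congr rfl fun j _ => ?_
  rw [one_div_mul_eq_div, one_div_mul_eq_div, one_div_mul_eq_div]
  exact div_mul_div_comm _ _ _ _

theorem coeff_connected_genus_zero (hk : 1 ≤ k) (hr : 1 ≤ r) (hq : 1 ≤ q) {l m : ℕ} (hl : 1 ≤ l)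
    (hm : 1 ≤ m) (b : ℕ) :
    PowerSeries.coeff (b * (r - 1)) (PowerSeries.coeff b (connected k r q ![l, m])) =
      if l + m = b * (q * (r - 1) + k) then
        1 / ((l : ℚ) * m) * ((k : ℚ) / r) ^ b * ∑ i ∈ Finset.range (b + 1),
          ((l - i * (q * (r - 1) + k) : ℕ) : ℚ) * Ring.choose ((l : ℚ) / ((k : ℚ) / r)) i *
            Ring.choose ((m : ℚ) / ((k : ℚ) / r)) (b - i)
      else 0 := by
  have key : ∀ i ∈ antidiagonal b, ∑ j ∈ antidiagonal (b * (r - 1)),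
      (vev (conjJ k r q l i.1 j.1 * conjJ k r q m i.2 j.2) -
        vev (conjJ k r q l i.1 j.1) * vev (conjJ k r q m i.2 j.2)) =
      if l + m = b * (q * (r - 1) + k) then
        ((k : ℚ) / r) ^ b * (((l - i.1 * (q * (r - 1) + k) : ℕ) : ℚ) *
          Ring.choose ((l : ℚ) / ((k : ℚ) / r)) i.1 *
            Ring.choose ((m : ℚ) / ((k : ℚ) / r)) i.2)
      else 0 := by
    rintro ⟨i₁, i₂⟩ hi
    rw [HasAntidiagonal.mem_antidiagonal] at hi
    subst hi
    dsimp only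
    -- Since `j₁ + j₂` is the sum of the two critical values, any other split has one index above
    -- its critical value, where the polynomial is zero.
    rw [Finset.sum_eq_single_of_mem (i₁ * (r - 1), i₂ * (r - 1))
      (by rw [HasAntidiagonal.mem_antidiagonal]; ring)]
    · obtain ⟨f, hf, hf1, -⟩ := conjJ_implements hk hr hq hl i₁ (i₁ * (r - 1))
      obtain ⟨g, hg, hg1, -⟩ := conjJ_implements hk hr hq hm i₂ (i₂ * (r - 1))
      rw [hf.vev_mul_sub hg, hf1 rfl, hg1 rfl]
      generalize r - 1 = r' at *
      have hcond : (-(l : ℤ) + k * i₁ + q * ((i₁ * r' : ℕ) : ℤ) +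
          (-(m : ℤ) + k * i₂ + q * ((i₂ * r' : ℕ) : ℤ)) = 0) ↔
          l + m = (i₁ + i₂) * (q * r' + k) := by
        zify
        constructor <;> intro h <;> linarith
      simp only [hcond]
      split_ifs with h
      -- The interval has length max(0, l - i₁B), which natural subtraction expresses.
      · have he : -(-(m : ℤ) + k * i₂ + q * ((i₂ * r' : ℕ) : ℤ)) =
            -((l : ℤ) - ((i₁ * (q * r' + k) : ℕ) : ℤ)) := by
          zify at h
          push_cast
          linarith
        simp only [Polynomial.eval_C, Finset.sum_const, Int.card_Ico, he, nsmul_eq_mul, zero_sub,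
          neg_neg, Int.toNat_sub, pow_add]
        ring
      · rfl
    · rintro ⟨j₁, j₂⟩ hj hne
      rw [HasAntidiagonal.mem_antidiagonal] at hj
      dsimp only at hj ⊢
      obtain ⟨f, hf, -, hf2⟩ := conjJ_implements hk hr hq hl i₁ j₁
      obtain ⟨g, hg, -, hg2⟩ := conjJ_implements hk hr hq hm i₂ j₂
      refine hf.vev_mul_sub_eq_zero hg ?_
      rw [add_mul] at hj
      rcases lt_trichotomy j₁ (i₁ * (r - 1)) with h | h | h
      · exact Or.inr (hg2 (by omega))
      · exact absurd (Prod.ext h (by dsimp only; omega)) hne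
      · exact Or.inl (hf2 h)
  rw [coeff_connected hk hq, Finset.sum_congr rfl key]
  split_ifs with h
  · rw [← Finset.mul_sum, Finset.Nat.sum_antidiagonal_eq_sum_range_succ_mk, mul_assoc]
  · simp

/-! ### Summation in closed form -/

theorem lh_genus_zero_pair (hr : 1 ≤ r) (l m : ℕ) :
    LeakyHurwitz.lh k r q 0 ![l, m] = ∑ᶠ b : ℕ, (b ! : ℚ) *
      PowerSeries.coeff (b * (r - 1)) (PowerSeries.coeff b (connected k r q ![l, m])) := by
  obtain ⟨r, rfl⟩ : ∃ s, r = s + 1 := ⟨r - 1, by omega⟩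
  rw [lh, Nat.add_sub_cancel]
  have hinj : Function.Injective fun b : ℕ => (b, b * r) := fun a b h => (Prod.ext_iff.1 h).1
  rw [← finsum_mem_univ (fun b : ℕ => _ * _),
    ← finsum_mem_image (s := Set.univ) (g := fun b : ℕ => (b, b * r))
      (f := fun p : ℕ × ℕ => (p.1 ! : ℚ) *
        PowerSeries.coeff p.2 (PowerSeries.coeff p.1 (connected k (r + 1) q ![l, m])))
      hinj.injOn, finsum_mem_def]
  classical
  refine finsum_congr fun p => ?_
  rw [Set.indicator_apply]
  refine if_congr ?_ rfl rfl
  rw [Set.image_univ, Set.mem_range]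
  push_cast
  constructor
  · intro h
    refine ⟨p.1, Prod.ext rfl ?_⟩
    zify
    linarith
  · rintro ⟨b, rfl⟩
    push_cast
    ring

theorem sum_truncated {x y A : ℚ} {l m b B : ℕ} (hA : A ≠ 0) (hB : 1 ≤ B) (hl : 1 ≤ l) (hm : 1 ≤ m)
    (hx : x = l / A) (hy : y = m / A) (h : l + m = b * B) :
    (b : ℚ) * ∑ i ∈ Finset.range (b + 1),
        ((l - i * B : ℕ) : ℚ) * Ring.choose x i * Ring.choose y (b - i) =
      l * m / A * Ring.choose (x - 1) (l / B) * Ring.choose (y - 1) (b - 1 - l / B) := by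
  have hA' : (B : ℚ) = A * (B / A) := by field_simp
  -- Uses `m ≥ 1`; terms with `i > l / B` vanish by natural subtraction.
  have htb : l / B < b := Nat.div_lt_of_lt_mul (by rw [mul_comm]; omega)
  have hsub : Finset.range (l / B + 1) ⊆ Finset.range (b + 1) :=
    Finset.range_subset_range.2 (by omega)
  have hlA : (l : ℚ) = A * x := by rw [hx]; field_simp
  have hmA : (m : ℚ) = A * y := by rw [hy]; field_simp
  have hsum : ∑ i ∈ Finset.range (b + 1),
        ((l - i * B : ℕ) : ℚ) * Ring.choose x i * Ring.choose y (b - i) =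
      A * ∑ i ∈ Finset.range (l / B + 1),
        (x - B / A * i) * Ring.choose x i * Ring.choose y (b - i) := by
    rw [← Finset.sum_subset hsub, Finset.mul_sum]
    · refine Finset.sum_congr rfl fun i hi => ?_
      rw [Finset.mem_range, Nat.lt_succ_iff, Nat.le_div_iff_mul_le hB] at hi
      rw [Nat.cast_sub hi, hlA]
      push_cast
      field_simp
    · intro i _ hi
      rw [Finset.mem_range, Nat.lt_succ_iff, Nat.le_div_iff_mul_le hB] at hi
      rw [Nat.sub_eq_zero_of_le (by omega)]
      simp
  have hxy : x + y = b * (B / A) := by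
    rw [hx, hy, ← add_div, ← Nat.cast_add, h]
    push_cast
    ring
  have key := sum_sub_mul_choose_mul_choose hxy (l / B) htb.le
  have h1 := mul_choose_sub_one x (l / B)
  have h2 : ((b : ℚ) - (l / B : ℕ)) * Ring.choose y (b - l / B) =
      y * Ring.choose (y - 1) (b - 1 - l / B) := by
    have h3 := mul_choose_sub_one y (b - 1 - l / B)
    have h4 := choose_succ_mul y (b - 1 - l / B)
    have h5 : b - 1 - l / B + 1 = b - l / B := by omega
    have h6 : ((b - 1 - l / B : ℕ) : ℚ) + 1 = (b : ℚ) - (l / B : ℕ) := by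
      rw [← Nat.cast_sub htb.le, ← h5]
      push_cast
      rfl
    rw [h5, h6] at h4
    rw [h3, mul_comm, h4]
    ring
  rw [hsum, mul_left_comm, key, ← h1, h2, hlA, hmA]
  field_simp

theorem lh_eq_zero (hk : 1 ≤ k) (hr : 1 ≤ r) (hq : 1 ≤ q) {l m : ℕ} (hl : 1 ≤ l) (hm : 1 ≤ m)
    (h : ¬ l + m ≡ 0 [MOD q * (r - 1) + k]) : LeakyHurwitz.lh k r q 0 ![l, m] = 0 := by
  rw [lh_genus_zero_pair hr]
  refine finsum_eq_zero_of_forall_eq_zero fun b => ?_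
  rw [coeff_connected_genus_zero hk hr hq hl hm, if_neg, mul_zero]
  intro hb
  exact h (Nat.modEq_zero_iff_dvd.2 ⟨b, by rw [hb, mul_comm]⟩)

/-- Covers both nonzero cases at once: only this `b` satisfies energy conservation, and the 1/b from
the telescoped sum equals B/(l+m). -/
theorem lh_eq (hk : 1 ≤ k) (hr : 1 ≤ r) (hq : 1 ≤ q) {l m b B : ℕ} (hl : 1 ≤ l) (hm : 1 ≤ m)
    {A : ℚ} (hA : A = (k : ℚ) / r) (hB : B = q * (r - 1) + k) (h : l + m = b * B) :
    LeakyHurwitz.lh k r q 0 ![l, m] =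
      (b ! : ℚ) / ((l : ℚ) + m) * A ^ ((b : ℤ) - 2) * B *
        (A * Ring.choose ((l : ℚ) / A - 1) (l / B) *
          Ring.choose ((m : ℚ) / A - 1) (b - 1 - l / B)) := by
  have hk' : (k : ℚ) ≠ 0 := by positivity
  have hr' : (r : ℚ) ≠ 0 := by positivity
  have hA0 : A ≠ 0 := by rw [hA]; exact div_ne_zero hk' hr'
  have hB1 : 1 ≤ B := by omega
  have hb : b ≠ 0 := by rintro rfl; omega
  have hsum := sum_truncated hA0 hB1 hl hm rfl rfl h
  rw [lh_genus_zero_pair hr, finsum_eq_single _ b]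
  · rw [coeff_connected_genus_zero hk hr hq hl hm, ← hB, ← hA, if_pos h, ← Nat.cast_add, h,
      zpow_sub₀ hA0, zpow_natCast]
    have hb' : (b : ℚ) ≠ 0 := Nat.cast_ne_zero.2 hb
    rw [mul_comm, ← eq_div_iff hb'] at hsum
    rw [hsum]
    have hl' : (l : ℚ) ≠ 0 := by positivity
    have hm' : (m : ℚ) ≠ 0 := by positivity
    have hB' : (B : ℚ) ≠ 0 := by positivity
    push_cast
    rw [show (2 : ℤ) = (2 : ℕ) by rfl, zpow_natCast]
    field_simp
  · intro c hc
    rw [coeff_connected_genus_zero hk hr hq hl hm, ← hB, if_neg, mul_zero]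
    intro h'
    exact hc (Nat.eq_of_mul_eq_mul_right hB1 (h'.symm.trans h))

end TwoPoint

end LeakyHurwitz

/-! ### The residue cases -/

theorem mainTheorem5 (k r q l m : ℕ) (hk : 1 ≤ k) (hr : 1 ≤ r) (hq : 1 ≤ q)
    (hl : 1 ≤ l) (hm : 1 ≤ m) (A : ℚ) (hA : A = (k : ℚ) / (r : ℚ))
    (B : ℕ) (hB : B = q * (r - 1) + k) :
    (¬ (l + m ≡ 0 [MOD B]) → LeakyHurwitz.lh k r q 0 ![l, m] = 0) ∧
    ((l : ℤ) ≡ -(m : ℤ) [ZMOD (B : ℤ)] → ¬ ((l : ℤ) ≡ 0 [ZMOD (B : ℤ)]) →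
      LeakyHurwitz.lh k r q 0 ![l, m] =
        (((l + m) / B)! : ℚ) / ((l : ℚ) + (m : ℚ)) * A ^ ((((l + m) / B : ℕ) : ℤ) - 2) * (B : ℚ) *
          (A * Ring.choose ((l : ℚ) / A - 1) (l / B) * Ring.choose ((m : ℚ) / A - 1) (m / B))) ∧
    (l ≡ 0 [MOD B] → m ≡ 0 [MOD B] →
      LeakyHurwitz.lh k r q 0 ![l, m] =
        (((l + m) / B)! : ℚ) / ((l : ℚ) + (m : ℚ)) * A ^ ((((l + m) / B : ℕ) : ℤ) - 2) * (B : ℚ) *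
          (((B : ℚ) - A) * Ring.choose ((l : ℚ) / A - 1) ((l - B) / B) *
            Ring.choose ((m : ℚ) / A - 1) ((m - B) / B))) := by
  have hB1 : 1 ≤ B := by omega
  refine ⟨fun h => LeakyHurwitz.lh_eq_zero hk hr hq hl hm (hB ▸ h), fun h hl0 => ?_,
    fun hl0 hm0 => ?_⟩
  · have hdvd : B ∣ l + m := by
      have h1 := h.symm.dvd
      rw [sub_neg_eq_add] at h1
      exact_mod_cast h1
    obtain ⟨b, hb⟩ := hdvd
    have hlB : ¬ B ∣ l := fun h => hl0 (Int.modEq_zero_iff_dvd.2 (Int.natCast_dvd_natCast.2 h))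
    -- As `B ∤ l`, the remainders of `l` and `m` add up to `B`, so the quotients add up to `b - 1`.
    have hmB : b - 1 - l / B = m / B := by
      have h1 := Nat.div_add_mod l B
      have h2 : 0 < l % B := Nat.pos_of_ne_zero fun h => hlB (Nat.dvd_of_mod_eq_zero h)
      have h3 := Nat.mod_lt l hB1
      have htb : l / B < b := Nat.div_lt_of_lt_mul (by omega)
      symm
      rw [Nat.div_eq_iff hB1]
      obtain ⟨j, rfl⟩ : ∃ j, b = l / B + 1 + j := ⟨b - (l / B + 1), by omega⟩
      rw [show l / B + 1 + j - 1 - l / B = j by omega]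
      rw [mul_add, mul_add, mul_one] at hb
      rw [mul_comm j B]
      omega
    rw [LeakyHurwitz.lh_eq hk hr hq hl hm hA hB (hb.trans (mul_comm _ _)), hb,
      Nat.mul_div_cancel_left _ hB1, hmB, ← Nat.cast_add, hb]
  · obtain ⟨s, rfl⟩ := Nat.modEq_zero_iff_dvd.1 hl0
    obtain ⟨t, rfl⟩ := Nat.modEq_zero_iff_dvd.1 hm0
    obtain ⟨s, rfl⟩ : ∃ s', s = s' + 1 := ⟨s - 1, by rcases s with _ | s <;> simp_all⟩
    obtain ⟨t, rfl⟩ : ∃ t', t = t' + 1 := ⟨t - 1, by rcases t with _ | t <;> simp_all⟩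
    have hA0 : A ≠ 0 := by
      rw [hA]
      positivity
    rw [LeakyHurwitz.lh_eq hk hr hq hl hm hA hB (b := s + 1 + (t + 1)) (by ring), ← mul_add,
      Nat.mul_div_cancel_left _ hB1, Nat.mul_div_cancel_left _ hB1]
    have h1 : ∀ j : ℕ, (B * (j + 1) - B) / B = j := fun j => by
      rw [mul_add, mul_one, Nat.add_sub_cancel, Nat.mul_div_cancel_left _ hB1]
    rw [h1, h1, show s + 1 + (t + 1) - 1 - (s + 1) = t by omega]
    have hs : (s : ℚ) + 1 ≠ 0 := by positivity
    have h2 := LeakyHurwitz.choose_succ_mul (((B * (s + 1) : ℕ) : ℚ) / A - 1) s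
    rw [← eq_div_iff hs] at h2
    -- With x = B(s+1)/A one has x - 1 - s = (s+1)(B-A)/A, so lowering the index by one turns the
    -- factor A into B - A.
    have h3 : A * Ring.choose (((B * (s + 1) : ℕ) : ℚ) / A - 1) (s + 1) =
        ((B : ℚ) - A) * Ring.choose (((B * (s + 1) : ℕ) : ℚ) / A - 1) s := by
      rw [h2]
      push_cast
      field_simp
      ring
    rw [h3]
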